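/- **Setting.** The $(m\times m)$-oriented grid has node set $[m]\times[m]$ and directed edges $(x,y)\to(x+1,y)$ (row edges) and $(x,y)\to(x,y+1)$ (column edges); nodes with equal $y$ form a row, nodes with equal $x$ a column. Paths and distances refer to the underlying undirected graph. A deterministic Online-LOCAL algorithm of locality $T$ has to color nodes that an adversary reveals one by one, $v_1,v_2,\dots$. When $v_i$ is revealed it must irrevocably give $v_i$ a color in $\{1,2,3\}$, knowing only the subgraph of the oriented grid induced by $\bigcup_{j\le i}B(v_j,T)$ (up to isomorphism, so without the coordinates of the nodes), the sequence $v_1,\dots,v_i$, and the colors given to $v_1,\dots,v_{i-1}$. We let the algorithm also see which edges are row edges and which are column edges; it is called *directed-only* if it does not use this information beyond the directions of the edges. The algorithm *3-colors the grid* if for every order in which all the nodes may be revealed, the resulting coloring is proper. For a coloring $c$ the potential of a step from $u$ to a neighbor $v$ is $p(u,v)=c(u)-c(v)$ if $c(u)\ne 3\ne c(v)$, and $0$ otherwise; the potential $p(W)$ of a walk $W$ is the sum over its steps. An *L-path* is a path that consists of a first part inside one row followed by a second part, with at least one edge, inside one column. The length of a part is its number of edges; $|W|$ is the number of nodes of $W$.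 **Lemma.** There is a constant $C\in\mathbb N$ such that the following holds for all $T,m\in\mathbb N$ with $m\ge 2^{C(T+1)}$ (in particular, if $T=o(\log n)$ with $n=m^2$, for all sufficiently large $n$), and for every deterministic Online-LOCAL algorithm of locality $T$ that 3-colors the $(m\times m)$-oriented grid. The adversary can reveal the nodes of some path $W$, and no other nodes, in such an order that, up to interchanging the words "row" and "column", * $W$ is an L-path, * the row part of $W$ has length at least $2^{100T}$, * the row part of $W$ is longer than the column part of $W$, * $|W|\le 2^{C(T+1)}$ (that is, $|W|\le 2^{O(T)}$), * $p(W)=0$ for the colors that the algorithm has given to the nodes of $W$. If the algorithm is directed-only, no interchange of the words "row" and "column" is needed. -/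

import Mathlib

namespace OnlineGrid

/-! ### The oriented grid -/

/-- Nodes `(x, y)` of the `m × m` grid. A row consists of the nodes with the same `y`,
a column of the nodes with the same `x`. -/
abbrev Node (m : ℕ) : Type := Fin m × Fin m

/-- The edges `(x, y) → (x + 1, y)`. -/
def East {m : ℕ} (u v : Node m) : Prop := u.1.val + 1 = v.1.val ∧ u.2 = v.2

/-- The edges `(x, y) → (x, y + 1)`. -/
def North {m : ℕ} (u v : Node m) : Prop := u.1 = v.1 ∧ u.2.val + 1 = v.2.val

/-- The underlying undirected graph of the oriented grid; paths and distances refer to it. -/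
def gridGraph (m : ℕ) : SimpleGraph (Node m) :=
  SimpleGraph.fromRel (fun u v => East u v ∨ North u v)

/-! ### Deterministic Online-LOCAL algorithms -/

/-- What an algorithm sees when it has to label a node: a graph on an anonymous vertex type with
two kinds of directed edges, the sequence `v₁, …, vᵢ` of the nodes revealed so far (the last one
is to be labelled now), and the labels given to `v₁, …, vᵢ₋₁`. -/
structure View (V : Type) where
  east : V → V → Prop
  north : V → V → Prop
  revealed : List V
  labels : List (Fin 3)

/-- The same view after renaming the vertices. -/
def View.rename {V W : Type} (e : V ≃ W) (a : View V) : View W where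
  east u v := a.east (e.symm u) (e.symm v)
  north u v := a.north (e.symm u) (e.symm v)
  revealed := a.revealed.map e
  labels := a.labels

/-- A deterministic algorithm: it labels the last revealed node of a view, and its answer does
not depend on the names of the vertices. The labels `0, 1, 2` stand for the colors `1, 2, 3`. -/
structure Algorithm where
  label : (V : Type) → View V → Fin 3
  label_rename : ∀ {V W : Type} (e : V ≃ W) (a : View V), label W (a.rename e) = label V a

/-- The algorithm uses the directions of the edges only, and not the information which of them
are row edges and which are column edges. -/
def Algorithm.DirectedOnly (A : Algorithm) : Prop :=
  ∀ (V : Type) (a b : View V), a.revealed = b.revealed → a.labels = b.labels →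
    (∀ u v, (a.east u v ∨ a.north u v) ↔ (b.east u v ∨ b.north u v)) →
    A.label V a = A.label V b

/-- The union of the balls of radius `T` around the nodes of `s`. -/
def seen (m T : ℕ) (s : List (Node m)) : Set (Node m) :=
  {v | ∃ u ∈ s, (gridGraph m).dist u v ≤ T}

theorem mem_seen (m T : ℕ) (s : List (Node m)) (u : Node m) (hu : u ∈ s) : u ∈ seen m T s :=
  ⟨u, hu, by simp⟩

/-- The view of an algorithm of locality `T` after the nodes of `s` have been revealed in this
order: the subgraph of the oriented grid induced by the union of the balls of radius `T`. -/
def gridView (m T : ℕ) (s : List (Node m)) (labels : List (Fin 3)) : View (seen m T s) where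
  east u v := East u.1 v.1
  north u v := North u.1 v.1
  revealed := s.attach.map (fun u => ⟨u.1, mem_seen m T s u.1 u.2⟩)
  labels := labels

/-- The labels that `A`, run with locality `T`, gives to the first `k` nodes of `s` when the nodes
of `s` are revealed in this order. -/
def Algorithm.outputs (A : Algorithm) (m T : ℕ) (s : List (Node m)) : ℕ → List (Fin 3)
  | 0 => []
  | k + 1 => A.outputs m T s k ++
      [A.label _ (gridView m T (s.take (k + 1)) (A.outputs m T s k))]

/-- The color that a node `v` of `s` gets when the nodes of `s` are revealed in this order
(only meaningful for `v ∈ s`). -/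
def Algorithm.color (A : Algorithm) (m T : ℕ) (s : List (Node m)) (v : Node m) : Fin 3 :=
  (A.outputs m T s s.length).getD (s.idxOf v) 0

/-- With locality `T`, the algorithm properly 3-colors the `m × m` oriented grid, in whatever
order all its nodes are revealed. -/
def Algorithm.Correct (A : Algorithm) (m T : ℕ) : Prop :=
  ∀ s : List (Node m), s.Nodup → (∀ v, v ∈ s) →
    ∀ u v, (gridGraph m).Adj u v → A.color m T s u ≠ A.color m T s v

/-! ### Potential and L-paths -/

/-- The potential `p(u, v)` of an edge: `c(u) - c(v)` if neither endpoint has the third color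
(the label `2`), and `0` otherwise. -/
def edgePotential {m : ℕ} (c : Node m → Fin 3) (u v : Node m) : ℤ :=
  if c u ≠ 2 ∧ c v ≠ 2 then ((c u).val : ℤ) - ((c v).val : ℤ) else 0

/-- The potential `p(W)` of a walk. -/
def potential {m : ℕ} (c : Node m → Fin 3) {u v : Node m} (W : (gridGraph m).Walk u v) : ℤ :=
  (W.darts.map (fun d => edgePotential c d.fst d.snd)).sum

/-- `W` is a path whose nodes up to its `i`-th one (counted from `0`) agree in the coordinate `f`,
and whose nodes from its `i`-th one on agree in the coordinate `g`; the second part has at least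
one edge. -/
structure IsLPathAlong {m : ℕ} (f g : Node m → Fin m) {u v : Node m}
    (W : (gridGraph m).Walk u v) (i : ℕ) : Prop where
  isPath : W.IsPath
  corner_lt : i < W.length
  first : ∀ k ≤ i, f (W.getVert k) = f (W.getVert i)
  second : ∀ k, i ≤ k → g (W.getVert k) = g (W.getVert i)

/-- `W` is an L-path, with its corner at the `i`-th node: a row segment with `i` edges followed by
a column segment with `W.length - i` edges. -/
def IsLPath {m : ℕ} {u v : Node m} (W : (gridGraph m).Walk u v) (i : ℕ) : Prop :=
  IsLPathAlong Prod.snd Prod.fst W i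

/-- `W` is an L-path of the grid with rows and columns interchanged. -/
def IsTransposedLPath {m : ℕ} {u v : Node m} (W : (gridGraph m).Walk u v) (i : ℕ) : Prop :=
  IsLPathAlong Prod.fst Prod.snd W i

end OnlineGrid

/-! In this range of `T` and `m` no correct algorithm exists, so the path is never constructed:
`Algorithm.not_correct` refutes `A.Correct m T`.

Two rigidity facts about proper 3-colorings are used. The potential is path-independent on unit
squares (`stepPotential_square`), so facing segments in rows at distance `d` have potentials
differing by at most `2 * d`. And the parity of a segment's potential is fixed by its length and its
two end colors (`even_rowPotential`). The adversary's freedom is that pieces more than `2 * T + 1`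
apart look unrelated to the algorithm, so their relative position may be settled after they are
colored (`labelAt_map`).

Upper bound: let a first row of length `M` have potential `q`. A later short segment of length `k`
can be slid next to a piece of that row with potential at most `q * k / M + 1`, or next to one with
at least `q * k / M - 1`. Hence it deviates from slope `q / M` by at most `4 * T + 5`
(`Algorithm.Correct.abs_deviation_le`).

Lower bound: glue two independently colored fragments with one of two consecutive gap lengths. By
parity, one of the choices makes the gap deviate by at least `1/4`, whatever colors it gets, and
either sign increases the difference between the extreme deviations. After `L` doublings this
difference is `L / 4` (`Algorithm.Correct.exists_fragment`). For `L = 32 * T + 41` it exceeds `2 *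
(4 * T + 5)`, while all lengths stay `2 ^ O(T + 1)`. -/

namespace OnlineGrid

/-! ### Distances in the grid -/

/-- The `ℓ¹` distance of two nodes. -/
def taxicab {m : ℕ} (u v : Node m) : ℕ :=
  ((u.1.val : ℤ) - v.1.val).natAbs + ((u.2.val : ℤ) - v.2.val).natAbs

theorem gridGraph_adj {m : ℕ} {u v : Node m} :
    (gridGraph m).Adj u v ↔ (East u v ∨ North u v) ∨ (East v u ∨ North v u) := by
  simp only [gridGraph, SimpleGraph.fromRel_adj, and_iff_right_iff_imp]
  rintro h rfl
  simp [East, North] at h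

theorem node_ext {m : ℕ} {u v : Node m} (h₁ : (u.1.val : ℤ) = v.1.val)
    (h₂ : (u.2.val : ℤ) = v.2.val) : u = v :=
  Prod.ext (Fin.ext (by exact_mod_cast h₁)) (Fin.ext (by exact_mod_cast h₂))

theorem taxicab_of_adj {m : ℕ} {u v : Node m} (h : (gridGraph m).Adj u v) : taxicab u v = 1 := by
  simp only [gridGraph_adj, East, North, Fin.ext_iff] at h
  unfold taxicab
  omega

theorem taxicab_triangle {m : ℕ} (u v w : Node m) : taxicab u w ≤ taxicab u v + taxicab v w := by
  unfold taxicab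
  omega

theorem taxicab_le_length {m : ℕ} {u v : Node m} (W : (gridGraph m).Walk u v) :
    taxicab u v ≤ W.length := by
  induction W with
  | nil => simp [taxicab]
  | cons h W ih =>
    have := taxicab_triangle _ _ _ |>.trans (Nat.add_le_add (taxicab_of_adj h).le ih)
    simp only [SimpleGraph.Walk.length_cons]
    omega

theorem exists_adj_taxicab {m n : ℕ} {u v : Node m} (h : taxicab u v = n + 1) :
    ∃ w, (gridGraph m).Adj u w ∧ taxicab w v = n := by
  obtain ⟨⟨a, ha⟩, ⟨b, hb⟩⟩ := u
  obtain ⟨⟨c, hc⟩, ⟨d, hd⟩⟩ := v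
  simp only [taxicab] at h
  rcases lt_trichotomy a c with h₁ | h₁ | h₁
  · refine ⟨(⟨a + 1, by omega⟩, ⟨b, hb⟩), ?_, ?_⟩
    · simp [gridGraph_adj, East]
    · simp only [taxicab]; omega
  · rcases lt_or_ge b d with h₂ | h₂
    · refine ⟨(⟨a, ha⟩, ⟨b + 1, by omega⟩), ?_, ?_⟩
      · simp [gridGraph_adj, North]
      · simp only [taxicab]; omega
    · refine ⟨(⟨a, ha⟩, ⟨b - 1, by omega⟩), ?_, ?_⟩
      · exact gridGraph_adj.2 (.inr (.inr ⟨rfl, show b - 1 + 1 = b by omega⟩))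
      · simp only [taxicab]; omega
  · refine ⟨(⟨a - 1, by omega⟩, ⟨b, hb⟩), ?_, ?_⟩
    · exact gridGraph_adj.2 (.inr (.inl ⟨show a - 1 + 1 = a by omega, rfl⟩))
    · simp only [taxicab]; omega

theorem exists_walk_length_eq_taxicab {m : ℕ} (n : ℕ) :
    ∀ {u v : Node m}, taxicab u v = n → ∃ W : (gridGraph m).Walk u v, W.length = n := by
  induction n with
  | zero =>
    intro u v h
    obtain rfl : u = v := node_ext (by unfold taxicab at h; omega) (by unfold taxicab at h; omega)
    exact ⟨.nil, rfl⟩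
  | succ n ih =>
    intro u v h
    obtain ⟨w, hw, h'⟩ := exists_adj_taxicab h
    obtain ⟨W, hW⟩ := ih h'
    exact ⟨.cons hw W, by simp [hW]⟩

theorem gridGraph_dist {m : ℕ} (u v : Node m) : (gridGraph m).dist u v = taxicab u v := by
  obtain ⟨W, hW⟩ := exists_walk_length_eq_taxicab _ (rfl : taxicab u v = _)
  refine le_antisymm (hW ▸ SimpleGraph.dist_le W) ?_
  obtain ⟨W', hW'⟩ := W.reachable.exists_walk_length_eq_dist
  exact hW' ▸ taxicab_le_length W'

theorem mem_seen_map {ι : Type*} {m T : ℕ} {l : List ι} {p : ι → Node m} {v : Node m} :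
    v ∈ seen m T (l.map p) ↔ ∃ i ∈ l, taxicab (p i) v ≤ T := by
  simp [seen, gridGraph_dist]

/-! ### Views that an algorithm cannot distinguish -/

/-- The ball of radius `T` around `u` does not touch the border of the grid. -/
def HasMargin (m T : ℕ) (u : Node m) : Prop :=
  T ≤ u.1.val ∧ u.1.val + T < m ∧ T ≤ u.2.val ∧ u.2.val + T < m

/-- `v' - u' = v - u`. -/
def SameOffset {m : ℕ} (u v u' v' : Node m) : Prop :=
  (v'.1.val : ℤ) - u'.1.val = v.1.val - u.1.val ∧ (v'.2.val : ℤ) - u'.2.val = v.2.val - u.2.val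

/-- Nodes at distance at most `2 * T + 1` have the same relative position under `p` and `p'`. -/
def SamePattern {ι : Type*} {m : ℕ} (T : ℕ) (l : List ι) (p p' : ι → Node m) : Prop :=
  ∀ i ∈ l, ∀ j ∈ l, taxicab (p i) (p j) ≤ 2 * T + 1 ∨ taxicab (p' i) (p' j) ≤ 2 * T + 1 →
    SameOffset (p i) (p j) (p' i) (p' j)

/-- `u'` lies relative to some `p' i` as `u` does relative to the nearby node `p i`. -/
def Corresponds {ι : Type*} {m : ℕ} (T : ℕ) (l : List ι) (p p' : ι → Node m) (u u' : Node m) :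
    Prop :=
  ∃ i ∈ l, taxicab (p i) u ≤ T ∧ SameOffset (p i) u (p' i) u'

section Corresponds
variable {ι : Type*} {m T : ℕ} {l : List ι} {p p' : ι → Node m} {u u' v v' : Node m}

theorem SamePattern.symm (h : SamePattern T l p p') : SamePattern T l p' p := fun i hi j hj hij =>
  ⟨(h i hi j hj hij.symm).1.symm, (h i hi j hj hij.symm).2.symm⟩

theorem Corresponds.symm (h : Corresponds T l p p' u u') : Corresponds T l p' p u' u := by
  obtain ⟨i, hi, hu, h₁, h₂⟩ := h
  refine ⟨i, hi, ?_, h₁.symm, h₂.symm⟩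
  unfold taxicab at *
  omega

theorem Corresponds.mem_seen (h : Corresponds T l p p' u u') : u ∈ seen m T (l.map p) :=
  mem_seen_map.2 (h.imp fun _ hi => ⟨hi.1, hi.2.1⟩)

theorem exists_corresponds (hp : ∀ i ∈ l, HasMargin m T (p' i)) (hu : u ∈ seen m T (l.map p)) :
    ∃ u', Corresponds T l p p' u u' := by
  obtain ⟨i, hi, h⟩ := mem_seen_map.1 hu
  obtain ⟨h₁, h₂, h₃, h₄⟩ := hp i hi
  have h' := h
  unfold taxicab at h'
  refine ⟨(⟨((p' i).1.val + u.1.val : ℤ).toNat - (p i).1.val, by omega⟩,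
    ⟨((p' i).2.val + u.2.val : ℤ).toNat - (p i).2.val, by omega⟩), i, hi, h, ?_, ?_⟩
  · dsimp only; omega
  · dsimp only; omega

/-- Balls of radius `T` that share a node or contain adjacent nodes have centers at distance at most
`2 * T + 1`, hence the threshold in `SamePattern`. Distance 0 makes the correspondence
single-valued; distance 1 makes it preserve edges. -/
theorem Corresponds.sameOffset (h : SamePattern T l p p') (hu : Corresponds T l p p' u u')
    (hv : Corresponds T l p p' v v') (huv : taxicab u v ≤ 1) : SameOffset u v u' v' := by
  obtain ⟨i, hi, hiu, h₁, h₂⟩ := hu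
  obtain ⟨j, hj, hjv, h₃, h₄⟩ := hv
  have := h i hi j hj (Or.inl (by unfold taxicab at *; omega))
  unfold SameOffset at *
  omega

theorem Corresponds.unique (h : SamePattern T l p p') (hu : Corresponds T l p p' u u')
    (hv : Corresponds T l p p' u v') : u' = v' := by
  have := hu.sameOffset h hv (by simp [taxicab])
  unfold SameOffset at this
  exact node_ext (by omega) (by omega)

theorem Corresponds.east (h : SamePattern T l p p') (hu : Corresponds T l p p' u u')
    (hv : Corresponds T l p p' v v') (huv : East u v) : East u' v' := by
  have := hu.sameOffset h hv (taxicab_of_adj (gridGraph_adj.2 (.inl (.inl huv)))).le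
  simp only [SameOffset, East, Fin.ext_iff] at *
  omega

theorem Corresponds.north (h : SamePattern T l p p') (hu : Corresponds T l p p' u u')
    (hv : Corresponds T l p p' v v') (huv : North u v) : North u' v' := by
  have := hu.sameOffset h hv (taxicab_of_adj (gridGraph_adj.2 (.inl (.inr huv)))).le
  simp only [SameOffset, North, Fin.ext_iff] at *
  omega

/-- The node of the second pattern that corresponds to a node seen in the first one. -/
noncomputable def partner (hp : ∀ i ∈ l, HasMargin m T (p' i)) (u : seen m T (l.map p)) :
    seen m T (l.map p') :=
  ⟨(exists_corresponds hp u.2).choose, (exists_corresponds hp u.2).choose_spec.symm.mem_seen⟩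

theorem corresponds_partner (hp : ∀ i ∈ l, HasMargin m T (p' i)) (u : seen m T (l.map p)) :
    Corresponds T l p p' u.1 (partner hp u).1 :=
  (exists_corresponds hp u.2).choose_spec

/-- The isomorphism between the seen parts of the grid. -/
noncomputable def seenEquiv (h : SamePattern T l p p') (hp : ∀ i ∈ l, HasMargin m T (p i))
    (hp' : ∀ i ∈ l, HasMargin m T (p' i)) :
    seen m T (l.map p) ≃ seen m T (l.map p') where
  toFun := partner hp'
  invFun := partner hp
  left_inv u := Subtype.ext <|
    (corresponds_partner hp _).unique h.symm (corresponds_partner hp' u).symm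
  right_inv u := Subtype.ext <|
    (corresponds_partner hp' _).unique h (corresponds_partner hp u).symm

theorem corresponds_seenEquiv (h : SamePattern T l p p') (hp : ∀ i ∈ l, HasMargin m T (p i))
    (hp' : ∀ i ∈ l, HasMargin m T (p' i)) (u : seen m T (l.map p)) :
    Corresponds T l p p' u.1 (seenEquiv h hp hp' u).1 :=
  corresponds_partner hp' u

theorem rename_gridView (h : SamePattern T l p p') (hp : ∀ i ∈ l, HasMargin m T (p i))
    (hp' : ∀ i ∈ l, HasMargin m T (p' i)) (c : List (Fin 3)) :
    (gridView m T (l.map p) c).rename (seenEquiv h hp hp') = gridView m T (l.map p') c := by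
  have key (u : seen m T (l.map p')) :
      Corresponds T l p p' ((seenEquiv h hp hp').symm u).1 u.1 := by
    simpa using corresponds_seenEquiv h hp hp' ((seenEquiv h hp hp').symm u)
  simp only [View.rename, gridView, View.mk.injEq, and_true]
  refine ⟨?_, ?_, ?_⟩
  · ext u v
    exact ⟨Corresponds.east h (key u) (key v), Corresponds.east h.symm (key u).symm (key v).symm⟩
  · ext u v
    exact ⟨Corresponds.north h (key u) (key v), Corresponds.north h.symm (key u).symm (key v).symm⟩
  · refine List.ext_getElem (by simp) fun n h₁ h₂ => Subtype.ext ?_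
    simp only [List.length_map, List.length_attach] at h₁
    simp only [List.getElem_map, List.getElem_attach]
    refine (corresponds_seenEquiv h hp hp' _).unique h
      ⟨l[n], List.getElem_mem h₁, ?_, ?_⟩
    · simp [taxicab]
    · simp [SameOffset]

end Corresponds

/-- By induction the earlier labels agree, so both views coincide up to renaming and the next labels
agree too. -/
theorem Algorithm.outputs_map_congr (A : Algorithm) {ι : Type*} {m T : ℕ} {l : List ι}
    {p p' : ι → Node m} (h : SamePattern T l p p') (hp : ∀ i ∈ l, HasMargin m T (p i))
    (hp' : ∀ i ∈ l, HasMargin m T (p' i)) (k : ℕ) :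
    A.outputs m T (l.map p) k = A.outputs m T (l.map p') k := by
  induction k with
  | zero => rfl
  | succ k ih =>
    have hl {i} (hi : i ∈ l.take (k + 1)) : i ∈ l := List.mem_of_mem_take hi
    have h₁ := rename_gridView (l := l.take (k + 1))
      (fun i hi j hj => h i (hl hi) j (hl hj)) (fun i hi => hp i (hl hi))
      (fun i hi => hp' i (hl hi)) (A.outputs m T (l.map p') k)
    simp only [Algorithm.outputs, ih]
    rw [← List.map_take, ← List.map_take, ← h₁, A.label_rename]

@[simp]
theorem Algorithm.length_outputs (A : Algorithm) (m T : ℕ) (s : List (Node m)) (k : ℕ) :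
    (A.outputs m T s k).length = k := by
  induction k with
  | zero => rfl
  | succ k ih => simp [Algorithm.outputs, ih]

theorem Algorithm.outputs_append (A : Algorithm) {m T : ℕ} (s t : List (Node m)) {k : ℕ}
    (hk : k ≤ s.length) : A.outputs m T (s ++ t) k = A.outputs m T s k := by
  induction k with
  | zero => rfl
  | succ k ih =>
    simp only [Algorithm.outputs, ih (by omega)]
    rw [List.take_append_of_le_length hk]

theorem Algorithm.outputs_prefix (A : Algorithm) {m T : ℕ} (s : List (Node m)) (k j : ℕ) :
    A.outputs m T s k <+: A.outputs m T s (k + j) := by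
  induction j with
  | zero => exact List.prefix_rfl
  | succ j ih => exact ih.trans (List.prefix_append _ _)

/-- Labels are irrevocable. -/
theorem Algorithm.color_append (A : Algorithm) {m T : ℕ} (s t : List (Node m)) {v : Node m}
    (hv : v ∈ s) : A.color m T (s ++ t) v = A.color m T s v := by
  have h := A.outputs_prefix (T := T) (s ++ t) s.length t.length
  rw [A.outputs_append s t le_rfl] at h
  obtain ⟨r, hr⟩ := h
  have hi := List.idxOf_lt_length_iff.2 hv
  unfold Algorithm.color
  rw [List.length_append, ← hr, List.idxOf_append_of_mem hv, List.getD_append]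
  simpa using hi

/-! ### Potentials along rows -/

/-- The potential of a step between nodes with the labels `a` and `b`. -/
def stepPotential (a b : Fin 3) : ℤ := if a ≠ 2 ∧ b ≠ 2 then (a.val : ℤ) - b.val else 0

theorem abs_stepPotential_le (a b : Fin 3) : |stepPotential a b| ≤ 1 := by
  revert a b; decide

/-- Between the first two colors a proper walk can only alternate, so two consecutive steps never
contribute the same nonzero sign. This bounds slopes by `1/2`. -/
theorem abs_stepPotential_add_le : ∀ {a b c : Fin 3}, a ≠ b → b ≠ c →
    |stepPotential a b + stepPotential b c| ≤ 1 := by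
  decide

/-- With three colors, some opposite corners of a properly colored 4-cycle agree, which makes its
total potential vanish. -/
theorem stepPotential_square : ∀ {a b c d : Fin 3}, a ≠ b → b ≠ d → a ≠ c → c ≠ d →
    stepPotential a b + stepPotential b d = stepPotential a c + stepPotential c d := by
  decide

/-- The parity defect of a walk that starts or ends in a node with the given label. -/
def parityDefect (a : Fin 3) : ℤ := if a = 2 then 1 else 0

theorem even_stepPotential : ∀ {a b : Fin 3}, a ≠ b →
    Even (stepPotential a b - 1 - parityDefect a - parityDefect b) := by
  decide

/-- The potential of the segment of length `n` that starts in `a`, for a row with labels `f`. -/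
def rowPotential (f : ℤ → Fin 3) (a : ℤ) (n : ℕ) : ℤ :=
  ∑ i ∈ Finset.range n, stepPotential (f (a + i)) (f (a + i + 1))

theorem rowPotential_add (f : ℤ → Fin 3) (a : ℤ) (n k : ℕ) :
    rowPotential f a (n + k) = rowPotential f a n + rowPotential f (a + n) k := by
  simp only [rowPotential, Finset.sum_range_add, Nat.cast_add, add_assoc]

theorem rowPotential_succ (f : ℤ → Fin 3) (a : ℤ) (n : ℕ) :
    rowPotential f a (n + 1) = rowPotential f a n + stepPotential (f (a + n)) (f (a + n + 1)) := by
  simp [rowPotential, Finset.sum_range_succ]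

theorem rowPotential_congr {f g : ℤ → Fin 3} {a b : ℤ} {n : ℕ}
    (h : ∀ i : ℤ, 0 ≤ i → i ≤ n → f (a + i) = g (b + i)) :
    rowPotential f a n = rowPotential g b n := by
  refine Finset.sum_congr rfl fun i hi => ?_
  have hi := Finset.mem_range.1 hi
  rw [h i (by omega) (by omega), add_assoc, add_assoc, h (i + 1) (by omega) (by omega)]

theorem abs_rowPotential_le (f : ℤ → Fin 3) (a : ℤ) (n : ℕ) : |rowPotential f a n| ≤ n := by
  refine (Finset.abs_sum_le_sum_abs _ _).trans ?_
  refine (Finset.sum_le_sum fun i _ => abs_stepPotential_le _ _).trans ?_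
  simp

theorem abs_rowPotential_two_mul_le {f : ℤ → Fin 3} {a : ℤ} {n : ℕ}
    (h : ∀ i : ℤ, a ≤ i → i < a + 2 * n → f i ≠ f (i + 1)) :
    |rowPotential f a (2 * n)| ≤ n := by
  induction n with
  | zero => simp [rowPotential]
  | succ n ih =>
    have h₁ := ih fun i hi hi' => h i hi (by push_cast; omega)
    have h₂ := abs_stepPotential_add_le (h (a + (2 * n : ℕ)) (by omega) (by push_cast; omega))
      (h (a + (2 * n : ℕ) + 1) (by omega) (by push_cast; omega))
    rw [show 2 * (n + 1) = 2 * n + 1 + 1 by ring, rowPotential_succ, rowPotential_succ]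
    rw [show a + ((2 * n + 1 : ℕ) : ℤ) = a + (2 * n : ℕ) + 1 by push_cast; ring]
    rw [abs_le] at *
    push_cast at *
    omega

/-- Summing `even_stepPotential`, every interior defect occurs twice; only the length and the two
ends remain modulo 2. -/
theorem even_rowPotential {f : ℤ → Fin 3} {a : ℤ} {n : ℕ}
    (h : ∀ i : ℤ, a ≤ i → i < a + n → f i ≠ f (i + 1)) :
    Even (rowPotential f a n - n - parityDefect (f a) - parityDefect (f (a + n))) := by
  induction n with
  | zero => exact ⟨-parityDefect (f a), by simp [rowPotential]; ring⟩
  | succ n ih =>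
    obtain ⟨r, hr⟩ := ih fun i hi hi' => h i hi (by push_cast; omega)
    obtain ⟨s, hs⟩ := even_stepPotential (h (a + n) (by omega) (by push_cast; omega))
    refine ⟨r + s + parityDefect (f (a + n)), ?_⟩
    rw [rowPotential_succ]
    push_cast
    rw [← add_assoc a]
    linarith

/-- The potentials of two rows at distance `d` differ by at most `2 * d`. -/
theorem abs_rowPotential_sub_le {c : ℤ × ℤ → Fin 3} {a y : ℤ} {n : ℕ} (d : ℕ)
    (hE : ∀ x y', a ≤ x → x < a + n → y ≤ y' → y' ≤ y + d → c (x, y') ≠ c (x + 1, y'))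
    (hN : ∀ x y', a ≤ x → x ≤ a + n → y ≤ y' → y' < y + d → c (x, y') ≠ c (x, y' + 1)) :
    |rowPotential (fun x => c (x, y + d)) a n - rowPotential (fun x => c (x, y)) a n| ≤
      2 * d := by
  induction d with
  | zero => simp
  | succ d ih =>
    have h₁ := ih (fun x y' h h' h'' h''' => hE x y' h h' h'' (by push_cast; omega))
      (fun x y' h h' h'' h''' => hN x y' h h' h'' (by push_cast; omega))
    -- Path independence on a strip of height one: along the lower row and then up equals up and
    -- then along the upper row. So raising the row by one costs only two vertical steps.
    have h₂ : ∀ k ≤ n, rowPotential (fun x => c (x, y + d)) a k +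
        stepPotential (c (a + k, y + d)) (c (a + k, y + d + 1)) =
        stepPotential (c (a, y + d)) (c (a, y + d + 1)) +
        rowPotential (fun x => c (x, y + (d + 1 : ℕ))) a k := by
      intro k hk
      induction k with
      | zero => simp [rowPotential]
      | succ k ihk =>
        have := ihk (by omega)
        rw [rowPotential_succ, rowPotential_succ]
        have h₃ := stepPotential_square
          (hE (a + k) (y + d) (by omega) (by omega) (by omega) (by push_cast; omega))
          (hN (a + k + 1) (y + d) (by omega) (by omega) (by omega) (by push_cast; omega))
          (hN (a + k) (y + d) (by omega) (by omega) (by omega) (by push_cast; omega))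
          (hE (a + k) (y + d + 1) (by omega) (by omega) (by omega) (by push_cast; omega))
        push_cast at *
        rw [← add_assoc a, ← add_assoc y] at *
        linarith
    have h₃ := h₂ n le_rfl
    have h₄ := abs_stepPotential_le (c (a + n, y + d)) (c (a + n, y + d + 1))
    have h₅ := abs_stepPotential_le (c (a, y + d)) (c (a, y + d + 1))
    rw [abs_le] at *
    push_cast at *
    constructor <;> linarith

/-! ### Arithmetic of slopes -/

/-- If the potential of a gap of unknown length has a known parity, then one of two consecutive
lengths makes it differ from the value given by a slope `q / M`. -/
theorem exists_gap {M q : ℤ} (hq : 2 * |q| ≤ M) (d e : ℤ) :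
    ∃ d', (d' = d ∨ d' = d + 1) ∧ ∀ v : ℤ, Even (v - d' - e) → M ≤ 4 * |M * v - q * d'| := by
  by_contra! H
  obtain ⟨v, ⟨r, hr⟩, hv⟩ := H d (.inl rfl)
  obtain ⟨w, ⟨s, hs⟩, hw⟩ := H (d + 1) (.inr rfl)
  have hM : 0 ≤ M := (by positivity : (0 : ℤ) ≤ 2 * |q|).trans hq
  -- The two values differ by an odd multiple of `M` minus `q`, hence by at least `M / 2`; both
  -- cannot be below `M / 4` in absolute value.
  have hw' : w = v + 1 + 2 * (s - r) := by linarith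
  have h₁ := le_abs_self (M * v - q * d)
  have h₂ := neg_abs_le (M * v - q * d)
  have h₃ := le_abs_self (M * w - q * (d + 1))
  have h₄ := neg_abs_le (M * w - q * (d + 1))
  have h₅ := le_abs_self q
  have h₆ := neg_abs_le q
  have h₇ : M * w - q * (d + 1) = M * v - q * d + M - q + 2 * (M * (s - r)) := by rw [hw']; ring
  rcases le_or_gt 0 (s - r) with h | h
  · have := mul_nonneg hM h
    linarith
  · have := mul_le_mul_of_nonneg_left (show s - r ≤ -1 by omega) hM
    linarith

/-- A function with `G 0 = G M` that changes by at most `2 * M` in each step increases by at most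
`M` on some interval of a given short length. -/
theorem exists_small_increment {G : ℕ → ℤ} {M n : ℕ} (h0 : G 0 = 0) (hM : G M = 0)
    (hG : ∀ x k, |G (x + k) - G x| ≤ 2 * M * k) (hn : 0 < n) (hnM : 2 * n ^ 2 ≤ M) :
    ∃ x, x + n ≤ M ∧ G (x + n) - G x ≤ M := by
  by_contra! H
  have hr : ∀ j, j * n ≤ M → (j * M : ℤ) ≤ G (j * n) := by
    intro j hj
    induction j with
    | zero => simp [h0]
    | succ j ih =>
      have h₁ := ih (le_trans (Nat.mul_le_mul_right _ (by omega)) hj)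
      have h₂ := H (j * n) (by rw [← Nat.succ_mul]; exact hj)
      rw [← Nat.succ_mul] at h₂
      push_cast
      simp only [Nat.succ_eq_add_one] at h₂
      linarith
  have h₁ := hr (M / n) (Nat.div_mul_le_self M n)
  have h₂ := hG (M / n * n) (M % n)
  rw [Nat.div_add_mod', hM] at h₂
  -- At least `2 * n` full blocks, each gaining more than `M`, outweigh the loss over the fewer than
  -- `n` remaining steps, so `G M = 0` fails.
  have h₃ : 2 * n ≤ M / n := (Nat.le_div_iff_mul_le hn).2 (by nlinarith)
  have h₄ : M % n < n := Nat.mod_lt _ hn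
  have hM0 : 0 < M := lt_of_lt_of_le (by positivity) hnM
  have h₅ : (2 * n * M : ℤ) ≤ (M / n : ℕ) * M := by exact_mod_cast Nat.mul_le_mul_right M h₃
  have h₆ : (2 * M * (M % n : ℕ) : ℤ) < 2 * M * n := by
    exact_mod_cast Nat.mul_lt_mul_of_pos_left h₄ (by positivity)
  have := (abs_le.1 h₂).1
  nlinarith

/-! ### Histories in the plane -/

/-- The node of the grid at the given position relative to the centre of the grid. -/
def place (m : ℕ) [NeZero m] (v : ℤ × ℤ) : Node m :=
  (Fin.ofNat m (v.1 + (m / 2 : ℕ)).toNat, Fin.ofNat m (v.2 + (m / 2 : ℕ)).toNat)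

/-- The ball of radius `T` around the point lies well inside the grid. -/
def Inside (m T : ℕ) (v : ℤ × ℤ) : Prop :=
  |v.1| + T < (m / 2 : ℕ) ∧ |v.2| + T < (m / 2 : ℕ)

/-- The map `f` moves points of `s` that are or get close to each other in the same way. -/
def IsRigid (T : ℕ) (s : List (ℤ × ℤ)) (f : ℤ × ℤ → ℤ × ℤ) : Prop :=
  ∀ u ∈ s, ∀ v ∈ s, |u.1 - v.1| + |u.2 - v.2| ≤ 2 * T + 1 ∨
    |(f u).1 - (f v).1| + |(f u).2 - (f v).2| ≤ 2 * T + 1 → f v - f u = v - u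

/-- The label of the point `v` when the points of `s` have been revealed in this order. -/
def Algorithm.labelAt (A : Algorithm) (m T : ℕ) [NeZero m] (s : List (ℤ × ℤ)) (v : ℤ × ℤ) :
    Fin 3 :=
  A.color m T (s.map (place m)) (place m v)

section Place
variable {m T : ℕ} [NeZero m] {u v : ℤ × ℤ}

theorem Inside.place_fst (h : Inside m T v) :
    ((place m v).1.val : ℤ) = v.1 + (m / 2 : ℕ) := by
  obtain ⟨h, -⟩ := h
  have := abs_lt.1 (show |v.1| < (m / 2 : ℕ) by omega)
  simp only [place, Fin.val_ofNat]
  rw [Nat.mod_eq_of_lt (by omega)]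
  omega

theorem Inside.place_snd (h : Inside m T v) :
    ((place m v).2.val : ℤ) = v.2 + (m / 2 : ℕ) := by
  obtain ⟨-, h⟩ := h
  have := abs_lt.1 (show |v.2| < (m / 2 : ℕ) by omega)
  simp only [place, Fin.val_ofNat]
  rw [Nat.mod_eq_of_lt (by omega)]
  omega

theorem Inside.hasMargin (h : Inside m T v) : HasMargin m T (place m v) := by
  have h₁ := h.place_fst
  have h₂ := h.place_snd
  have h₃ := abs_lt.1 (show |v.1| < (m / 2 : ℕ) - T by have := h.1; omega)
  have h₄ := abs_lt.1 (show |v.2| < (m / 2 : ℕ) - T by have := h.2; omega)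
  refine ⟨?_, ?_, ?_, ?_⟩ <;> omega

theorem Inside.place_inj (hu : Inside m T u) (hv : Inside m T v) (h : place m u = place m v) :
    u = v := by
  have h₁ := hu.place_fst
  have h₂ := hu.place_snd
  rw [h, hv.place_fst] at h₁
  rw [h, hv.place_snd] at h₂
  exact Prod.ext (by omega) (by omega)

theorem Inside.taxicab_place (hu : Inside m T u) (hv : Inside m T v) :
    (taxicab (place m u) (place m v) : ℤ) = |u.1 - v.1| + |u.2 - v.2| := by
  unfold taxicab
  rw [hu.place_fst, hu.place_snd, hv.place_fst, hv.place_snd]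
  push_cast
  congr 2 <;> ring

theorem adj_place_of_east (hu : Inside m T u) (hv : Inside m T (u.1 + 1, u.2)) :
    (gridGraph m).Adj (place m u) (place m (u.1 + 1, u.2)) := by
  refine gridGraph_adj.2 (.inl (.inl ⟨?_, Fin.ext ?_⟩))
  · have h₁ := hu.place_fst
    have h₂ := hv.place_fst
    dsimp only at h₂
    omega
  · have h₁ := hu.place_snd
    have h₂ := hv.place_snd
    dsimp only at h₂
    omega

theorem adj_place_of_north (hu : Inside m T u) (hv : Inside m T (u.1, u.2 + 1)) :
    (gridGraph m).Adj (place m u) (place m (u.1, u.2 + 1)) := by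
  refine gridGraph_adj.2 (.inl (.inr ⟨Fin.ext ?_, ?_⟩))
  · have h₁ := hu.place_fst
    have h₂ := hv.place_fst
    dsimp only at h₂
    omega
  · have h₁ := hu.place_snd
    have h₂ := hv.place_snd
    dsimp only at h₂
    omega

end Place

theorem idxOf_map_of_injOn {α β : Type*} [BEq α] [LawfulBEq α] [BEq β]
    [LawfulBEq β] {f : α → β} {s : List α}
    {v : α} (h : ∀ u ∈ s, f u = f v → u = v) : (s.map f).idxOf (f v) = s.idxOf v := by
  induction s with
  | nil => rfl
  | cons a s ih =>
    have ih := ih fun u hu => h u (List.mem_cons_of_mem _ hu)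
    by_cases hav : a = v
    · simp [hav]
    · have : f a ≠ f v := fun h' => hav (h a List.mem_cons_self h')
      simp [List.idxOf_cons_ne _ hav, List.idxOf_cons_ne _ this, ih]

section LabelAt
variable {A : Algorithm} {m T : ℕ} [NeZero m] {s : List (ℤ × ℤ)} {v : ℤ × ℤ}

theorem labelAt_append (t : List (ℤ × ℤ)) (hv : v ∈ s) :
    A.labelAt m T (s ++ t) v = A.labelAt m T s v := by
  unfold Algorithm.labelAt
  rw [List.map_append, A.color_append _ _ (List.mem_map_of_mem hv)]

/-- This lets the adversary rearrange the past: a rigid motion of the pieces is invisible to the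
algorithm, so the labels move along. -/
theorem labelAt_map {f : ℤ × ℤ → ℤ × ℤ} (hs : ∀ u ∈ s, Inside m T u)
    (hfs : ∀ u ∈ s, Inside m T (f u)) (hf : IsRigid T s f) (hv : v ∈ s) :
    A.labelAt m T (s.map f) (f v) = A.labelAt m T s v := by
  have hinj : ∀ u ∈ s, f u = f v → u = v := by
    intro u hu h
    have := hf u hu v hv (Or.inr (by simp [h]; positivity))
    rw [h, sub_self, eq_comm, sub_eq_zero] at this
    exact this.symm
  have hpat : SamePattern T s (place m) (place m ∘ f) := by
    intro u hu v hv h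
    have h₁ := (hs u hu).taxicab_place (hs v hv)
    have h₂ := (hfs u hu).taxicab_place (hfs v hv)
    have h₃ := hf u hu v hv (h.imp (fun h => by rw [← h₁]; exact_mod_cast h)
      (fun h => by rw [← h₂]; exact_mod_cast h))
    have h₄ := congrArg Prod.fst h₃
    have h₅ := congrArg Prod.snd h₃
    simp only [Prod.fst_sub, Prod.snd_sub] at h₄ h₅
    simp only [SameOffset, Function.comp, (hs u hu).place_fst, (hs u hu).place_snd,
      (hs v hv).place_fst, (hs v hv).place_snd, (hfs u hu).place_fst, (hfs u hu).place_snd,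
      (hfs v hv).place_fst, (hfs v hv).place_snd]
    constructor <;> linarith
  unfold Algorithm.labelAt Algorithm.color
  have h₁ : (s.map (place m)).idxOf (place m v) = s.idxOf v :=
    idxOf_map_of_injOn fun u hu h => (hs u hu).place_inj (hs v hv) h
  have h₂ : (s.map (place m ∘ f)).idxOf ((place m ∘ f) v) = s.idxOf v :=
    idxOf_map_of_injOn fun u hu h => hinj u hu ((hfs u hu).place_inj (hfs v hv) h)
  rw [List.map_map, h₁, show place m (f v) = (place m ∘ f) v from rfl, h₂,
    A.outputs_map_congr hpat (fun u hu => (hs u hu).hasMargin) (fun u hu => (hfs u hu).hasMargin)]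
  simp

/-- The labels that a correct algorithm has given can be completed to a proper coloring. -/
theorem Algorithm.Correct.exists_extension (hA : A.Correct m T) (hnd : s.Nodup)
    (hs : ∀ u ∈ s, Inside m T u) :
    ∃ c : ℤ × ℤ → Fin 3, (∀ v ∈ s, c v = A.labelAt m T s v) ∧
      (∀ x y, Inside m T (x, y) → Inside m T (x + 1, y) → c (x, y) ≠ c (x + 1, y)) ∧
      ∀ x y, Inside m T (x, y) → Inside m T (x, y + 1) → c (x, y) ≠ c (x, y + 1) := by
  classical
  set r : List (Node m) := (Finset.univ.filter (· ∉ s.map (place m))).toList with hr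
  -- Revealing all remaining nodes afterwards produces a full run, to which correctness applies
  -- without changing earlier labels.
  have hmem (v : Node m) : v ∈ s.map (place m) ++ r := by
    rw [List.mem_append, hr, Finset.mem_toList, Finset.mem_filter]
    by_cases h : v ∈ s.map (place m)
    · exact .inl h
    · exact .inr ⟨Finset.mem_univ _, h⟩
  have hnodup : (s.map (place m) ++ r).Nodup := by
    refine List.Nodup.append ?_ (Finset.nodup_toList _) ?_
    · exact List.Nodup.map_on (fun u hu v hv h => (hs u hu).place_inj (hs v hv) h) hnd
    · intro v hv hv'
      rw [hr, Finset.mem_toList, Finset.mem_filter] at hv'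
      exact hv'.2 hv
  refine ⟨fun v => A.color m T (s.map (place m) ++ r) (place m v), ?_, ?_, ?_⟩
  · intro v hv
    exact A.color_append _ _ (List.mem_map_of_mem hv)
  · intro x y hu hv
    exact hA _ hnodup hmem _ _ (adj_place_of_east hu hv)
  · intro x y hu hv
    exact hA _ hnodup hmem _ _ (adj_place_of_north hu hv)

end LabelAt

/-! ### Forcing a deviation from a given slope -/

/-- The deviation of the potential of a segment from the slope `q / M`, multiplied by `M`. -/
def deviation (M q : ℤ) (f : ℤ → Fin 3) (a : ℤ) (n : ℕ) : ℤ := M * rowPotential f a n - q * n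

theorem deviation_add (M q : ℤ) (f : ℤ → Fin 3) (a : ℤ) (n k : ℕ) :
    deviation M q f a (n + k) = deviation M q f a n + deviation M q f (a + n) k := by
  simp only [deviation, rowPotential_add]
  push_cast
  ring

theorem deviation_congr {M q : ℤ} {f g : ℤ → Fin 3} {a b : ℤ} {n : ℕ}
    (h : ∀ i : ℤ, 0 ≤ i → i ≤ n → f (a + i) = g (b + i)) :
    deviation M q f a n = deviation M q g b n := by
  rw [deviation, deviation, rowPotential_congr h]

/-- The deviations of two segments of `[0, w]` differ by at least `L * M / 4`. -/
def HasSpread (M q : ℤ) (f : ℤ → Fin 3) (w L : ℕ) : Prop :=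
  ∃ a n b k : ℕ, a + n ≤ w ∧ b + k ≤ w ∧ L * M ≤ 4 * (deviation M q f b k - deviation M q f a n)

/-- The relevant gap runs from the end of the low segment of the first fragment to the start of the
high segment of the second. The offset `D` is fixed before the gap is colored, so it must work for
every coloring `f`. -/
theorem exists_hasSpread_of_gap {M q : ℤ} (hq : 2 * |q| ≤ M) {f₁ f₂ : ℤ → Fin 3} {w₁ w₂ L : ℕ}
    (h₁ : HasSpread M q f₁ w₁ L) (h₂ : HasSpread M q f₂ w₂ L) (g : ℕ) :
    ∃ D : ℕ, w₁ + g ≤ D ∧ D ≤ w₁ + g + 1 ∧ ∀ f : ℤ → Fin 3,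
      (∀ i : ℤ, 0 ≤ i → i ≤ w₁ → f i = f₁ i) → (∀ i : ℤ, 0 ≤ i → i ≤ w₂ → f (i + D) = f₂ i) →
      (∀ i : ℤ, 0 ≤ i → i < D + w₂ → f i ≠ f (i + 1)) → HasSpread M q f (D + w₂) (L + 1) := by
  obtain ⟨a₁, n₁, b₁, k₁, ha₁, hb₁, hs₁⟩ := h₁
  obtain ⟨a₂, n₂, b₂, k₂, ha₂, hb₂, hs₂⟩ := h₂
  obtain ⟨d', hd', hgap⟩ := exists_gap hq (w₁ + g + b₂ - (a₁ + n₁))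
    (parityDefect (f₁ (a₁ + n₁)) + parityDefect (f₂ b₂))
  obtain ⟨d, rfl⟩ : ∃ d : ℕ, d' = d := ⟨d'.toNat, by omega⟩
  obtain ⟨D, hD⟩ : ∃ D : ℕ, D + b₂ = d + (a₁ + n₁) := ⟨d + (a₁ + n₁) - b₂, by omega⟩
  refine ⟨D, by omega, by omega, fun f hf₁ hf₂ hf => ?_⟩
  have e₁ : deviation M q f a₁ n₁ = deviation M q f₁ a₁ n₁ :=
    deviation_congr fun i hi hi' => hf₁ _ (by omega) (by omega)
  have e₂ : deviation M q f b₁ k₁ = deviation M q f₁ b₁ k₁ :=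
    deviation_congr fun i hi hi' => hf₁ _ (by omega) (by omega)
  have e₃ : deviation M q f (a₂ + D : ℕ) n₂ = deviation M q f₂ a₂ n₂ :=
    deviation_congr fun i hi hi' => by
      rw [← hf₂ _ (by omega) (by omega)]; congr 1; push_cast; ring
  have e₄ : deviation M q f (b₂ + D : ℕ) k₂ = deviation M q f₂ b₂ k₂ :=
    deviation_congr fun i hi hi' => by
      rw [← hf₂ _ (by omega) (by omega)]; congr 1; push_cast; ring
  have e₅ : ((b₂ + D : ℕ) : ℤ) = (a₁ + n₁ : ℕ) + d := by omega
  have heven := even_rowPotential (f := f) (a := (a₁ + n₁ : ℕ)) (n := d)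
    fun i hi hi' => hf i (by omega) (by omega)
  rw [← e₅, Nat.cast_add b₂, hf₂ b₂ (by omega) (by omega), hf₁ _ (by omega) (by omega),
    Nat.cast_add, sub_sub _ (parityDefect _)] at heven
  have hdev := hgap _ heven
  rw [← Nat.cast_add] at hdev
  change M ≤ 4 * |deviation M q f (a₁ + n₁ : ℕ) d| at hdev
  -- If the gap deviates upward, prepend it to the second fragment's high segment; if downward,
  -- append it to the first fragment's low segment.
  rcases le_total 0 (deviation M q f (a₁ + n₁ : ℕ) d) with h | h
  · rw [abs_of_nonneg h] at hdev
    refine ⟨a₂ + D, n₂, a₁ + n₁, d + k₂, by omega, by omega, ?_⟩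
    rw [deviation_add, ← e₅, e₃, e₄]
    push_cast at *
    linarith
  · rw [abs_of_nonpos h] at hdev
    refine ⟨a₁, n₁ + d, b₁, k₁, by omega, by omega, ?_⟩
    rw [deviation_add, ← Nat.cast_add, e₁, e₂]
    push_cast at *
    linarith

/-! ### Rows of points and their translations -/

/-- The points of the row `y` with the given first coordinates. -/
def inRow (y : ℤ) (t : List ℤ) : List (ℤ × ℤ) := t.map fun x => (x, y)

theorem mem_inRow {y : ℤ} {t : List ℤ} {v : ℤ × ℤ} : v ∈ inRow y t ↔ v.1 ∈ t ∧ v.2 = y := by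
  obtain ⟨a, b⟩ := v
  simp [inRow, eq_comm]

theorem inRow_append (y : ℤ) (s t : List ℤ) : inRow y (s ++ t) = inRow y s ++ inRow y t :=
  List.map_append

theorem nodup_append_inRow {h : List (ℤ × ℤ)} {t : List ℤ} {y : ℤ} (hh : h.Nodup) (ht : t.Nodup)
    (hy : ∀ v ∈ h, v.2 < y) : (h ++ inRow y t).Nodup := by
  refine hh.append (ht.map fun a b hab => (Prod.mk.inj hab).1) fun v hv hv' => ?_
  exact (hy v hv).ne (mem_inRow.1 hv').2

/-- Moving the points of the row `y` by `(d, e)`. -/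
def shiftRow (y d e : ℤ) (v : ℤ × ℤ) : ℤ × ℤ := if v.2 = y then (v.1 + d, v.2 + e) else v

theorem isRigid_shiftRow {T : ℕ} {s : List (ℤ × ℤ)} {y d e : ℤ}
    (h : ∀ u ∈ s, ∀ v ∈ s, u.2 = y → v.2 ≠ y → 2 * T + 1 < |u.1 - v.1| + |u.2 - v.2| ∧
      2 * T + 1 < |u.1 + d - v.1| + |u.2 + e - v.2|) : IsRigid T s (shiftRow y d e) := by
  intro u hu v hv huv
  by_cases hu' : u.2 = y <;> by_cases hv' : v.2 = y
  · simp [shiftRow, hu', hv', Prod.ext_iff]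
  · obtain ⟨h₁, h₂⟩ := h u hu v hv hu' hv'
    simp only [shiftRow, hu', hv', if_true, if_false] at huv h₁ h₂
    rcases huv with h' | h' <;> linarith
  · obtain ⟨h₁, h₂⟩ := h v hv u hu hv' hu'
    simp only [shiftRow, hu', hv', if_true, if_false] at huv h₁ h₂
    rw [abs_sub_comm, abs_sub_comm u.2, abs_sub_comm u.1 (v.1 + d),
      abs_sub_comm u.2 (y + e)] at huv
    rcases huv with h' | h' <;> linarith
  · simp [shiftRow, hu', hv']

theorem map_shiftRow_of_ne {s : List (ℤ × ℤ)} {y d e : ℤ} (h : ∀ v ∈ s, v.2 ≠ y) :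
    s.map (shiftRow y d e) = s :=
  (List.map_congr_left fun v hv => by simp [shiftRow, h v hv]).trans (List.map_id s)

theorem map_shiftRow_inRow (y d e : ℤ) (t : List ℤ) :
    (inRow y t).map (shiftRow y d e) = inRow (y + e) (t.map (· + d)) := by
  simp [inRow, shiftRow, Function.comp_def]

/-- The integers `a, a + 1, …, a + n - 1`. -/
def intRange (a : ℤ) (n : ℕ) : List ℤ := (List.range n).map fun i : ℕ => a + i

theorem mem_intRange {a x : ℤ} {n : ℕ} : x ∈ intRange a n ↔ a ≤ x ∧ x < a + n := by
  simp only [intRange, List.mem_map, List.mem_range]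
  constructor
  · rintro ⟨i, hi, rfl⟩; omega
  · rintro ⟨h₁, h₂⟩; exact ⟨(x - a).toNat, by omega, by omega⟩

theorem nodup_intRange (a : ℤ) (n : ℕ) : (intRange a n).Nodup :=
  List.nodup_range.map fun i j h => by simpa using h

theorem inside_iff {m T : ℕ} {v : ℤ × ℤ} : Inside m T v ↔
    (-((m / 2 : ℕ) - T : ℤ) < v.1 ∧ v.1 < (m / 2 : ℕ) - T) ∧
    (-((m / 2 : ℕ) - T : ℤ) < v.2 ∧ v.2 < (m / 2 : ℕ) - T) := by
  rw [← abs_lt, ← abs_lt, Inside]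
  constructor <;> rintro ⟨h₁, h₂⟩ <;> constructor <;> linarith

/-! ### The adversary's constructions and the contradiction -/

variable {A : Algorithm} {m T : ℕ} [NeZero m]

/-- After any history, the adversary can reveal a segment of a fresh row with a large spread. -/
theorem Algorithm.Correct.exists_fragment (hA : A.Correct m T) {M q : ℤ} (hq : 2 * |q| ≤ M)
    (L : ℕ) : ∀ (h : List (ℤ × ℤ)) (y : ℤ), h.Nodup →
      (∀ v ∈ h, Inside m T v ∧ v.2 + (2 * T + 2) ≤ y) → 0 ≤ y →
      y + L * (2 * T + 2) + T < (m / 2 : ℕ) → 2 ^ L * (2 * T + 4) + T < m / 2 →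
      ∃ (w : ℕ) (t : List ℤ), w + (2 * T + 4) ≤ 2 ^ L * (2 * T + 4) ∧ t.Nodup ∧
        (∀ x, x ∈ t ↔ 0 ≤ x ∧ x ≤ w) ∧
        HasSpread M q (fun x => A.labelAt m T (h ++ inRow y t) (x, y)) w L := by
  induction L with
  | zero =>
    intro h y _ _ _ _ _
    refine ⟨0, [0], by simp, by simp, fun x => ?_, 0, 0, 0, 0, by simp, by simp, by simp⟩
    rw [List.mem_singleton]; push_cast; omega
  | succ L ih =>
    intro h y hnd hh hy hyL hL
    set g : ℤ := 2 * T + 2 with hg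
    have hg0 : 0 ≤ g := by positivity
    have hLg : 0 ≤ L * g := by positivity
    have hpow : 2 ^ (L + 1) * (2 * T + 4) = 2 * (2 ^ L * (2 * T + 4)) := by ring
    rw [hpow] at hL ⊢
    rw [Nat.cast_succ, add_one_mul] at hyL
    set K := 2 ^ L * (2 * T + 4)
    obtain ⟨w₁, t₁, hw₁, hn₁, ht₁, hs₁⟩ := ih h y hnd hh hy (by linarith) (by omega)
    have hh' : ∀ v ∈ h ++ inRow y t₁, Inside m T v ∧ v.2 + g ≤ y + g := by
      intro v hv
      rcases List.mem_append.1 hv with hv | hv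
      · exact ⟨(hh v hv).1, by linarith [(hh v hv).2]⟩
      · obtain ⟨h₁, h₂⟩ := mem_inRow.1 hv
        have h₁ := (ht₁ _).1 h₁
        rw [inside_iff]
        refine ⟨⟨⟨?_, ?_⟩, ?_, ?_⟩, ?_⟩ <;> omega
    obtain ⟨w₂, t₂, hw₂, hn₂, ht₂, hs₂⟩ := ih (h ++ inRow y t₁) (y + g)
      (nodup_append_inRow hnd hn₁ fun v hv => by linarith [(hh v hv).2])
      hh' (by linarith) (by linarith) (by omega)
    -- Gap parameter `2 * T + 2` keeps the fragments beyond `2 * T + 1` after the slide. The seam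
    -- costs at most `2 * T + 3`, so width plus `2 * T + 4` at most doubles.
    obtain ⟨D, hD₁, hD₂, hD⟩ := exists_hasSpread_of_gap hq hs₁ hs₂ (2 * T + 2)
    set s := h ++ inRow y t₁ ++ inRow (y + g) t₂ with hs
    -- The second fragment is slid down into row `y`; only then are the gap nodes `t₃` revealed.
    set f := shiftRow (y + g) D (-g) with hf
    set t₃ := intRange (w₁ + 1) (D - w₁ - 1) with ht₃
    have hsf : s.map f = h ++ inRow y t₁ ++ inRow y (t₂.map (· + (D : ℤ))) := by
      rw [hs, List.map_append, map_shiftRow_of_ne fun v hv => by linarith [(hh' v hv).2],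
        map_shiftRow_inRow, add_neg_cancel_right]
    have hsf' : h ++ inRow y (t₁ ++ t₂.map (· + (D : ℤ)) ++ t₃) = s.map f ++ inRow y t₃ := by
      rw [hsf, inRow_append, inRow_append]
      simp only [List.append_assoc]
    have hnd' : (t₁ ++ t₂.map (· + (D : ℤ)) ++ t₃).Nodup := by
      refine (hn₁.append (hn₂.map (add_left_injective _)) ?_).append (nodup_intRange _ _) ?_
      · intro x hx hx'
        obtain ⟨z, hz, rfl⟩ := List.mem_map.1 hx'
        have := (ht₁ _).1 hx
        have := (ht₂ _).1 hz
        omega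
      · intro x hx hx'
        have := mem_intRange.1 hx'
        rcases List.mem_append.1 hx with hx | hx
        · have := (ht₁ _).1 hx
          omega
        · obtain ⟨z, hz, rfl⟩ := List.mem_map.1 hx
          have := (ht₂ _).1 hz
          omega
    have hmem : ∀ x, x ∈ t₁ ++ t₂.map (· + (D : ℤ)) ++ t₃ ↔ 0 ≤ x ∧ x ≤ (D + w₂ : ℕ) := by
      intro x
      simp only [List.mem_append, List.mem_map, ht₁, ht₂, ht₃, mem_intRange]
      constructor
      · rintro ((h | ⟨z, h, rfl⟩) | h) <;> omega
      · intro h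
        rcases le_or_gt x w₁ with h₁ | h₁
        · exact .inl (.inl ⟨h.1, h₁⟩)
        · rcases lt_or_ge x D with h₂ | h₂
          · exact .inr ⟨by omega, by omega⟩
          · exact .inl (.inr ⟨x - D, by omega, by omega⟩)
    have hin : ∀ v ∈ h ++ inRow y (t₁ ++ t₂.map (· + (D : ℤ)) ++ t₃), Inside m T v := by
      intro v hv
      rcases List.mem_append.1 hv with hv | hv
      · exact (hh v hv).1
      · obtain ⟨h₁, h₂⟩ := mem_inRow.1 hv
        have h₁ := (hmem _).1 h₁
        rw [inside_iff]
        refine ⟨⟨?_, ?_⟩, ?_, ?_⟩ <;> omega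
    have hins : ∀ v ∈ s, Inside m T v := by
      intro v hv
      rcases List.mem_append.1 hv with hv | hv
      · exact (hh' v hv).1
      · obtain ⟨h₁, h₂⟩ := mem_inRow.1 hv
        have h₁ := (ht₂ _).1 h₁
        rw [inside_iff]
        refine ⟨⟨?_, ?_⟩, ?_, ?_⟩ <;> omega
    have hrigid : IsRigid T s f := by
      refine isRigid_shiftRow fun u hu v hv hu' hv' => ?_
      have hu : u.1 ∈ t₂ := by
        rcases List.mem_append.1 hu with hu | hu
        · linarith [(hh' u hu).2]
        · exact (mem_inRow.1 hu).1
      have hu := (ht₂ _).1 hu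
      rcases List.mem_append.1 hv with hv | hv
      · rcases List.mem_append.1 hv with hv | hv
        · have h₁ := (hh v hv).2
          have h₂ := le_abs_self (u.2 - v.2)
          have h₃ := le_abs_self (u.2 + -g - v.2)
          have h₄ := abs_nonneg (u.1 - v.1)
          have h₅ := abs_nonneg (u.1 + D - v.1)
          constructor <;> linarith
        · obtain ⟨h₁, h₂⟩ := mem_inRow.1 hv
          have h₁ := (ht₁ _).1 h₁
          have h₂ := le_abs_self (u.2 - v.2)
          have h₃ := le_abs_self (u.1 + D - v.1)
          have h₄ := abs_nonneg (u.1 - v.1)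
          have h₅ := abs_nonneg (u.2 + -g - v.2)
          constructor
          · linarith
          · omega
      · exact absurd (mem_inRow.1 hv).2 hv'
    refine ⟨D + w₂, t₁ ++ t₂.map (· + (D : ℤ)) ++ t₃, by omega, hnd', hmem,
      hD _ ?_ ?_ ?_⟩
    · intro i hi hi'
      have h₁ : (i, y) ∈ inRow y t₁ := mem_inRow.2 ⟨(ht₁ i).2 ⟨hi, hi'⟩, rfl⟩
      rw [inRow_append, inRow_append, ← List.append_assoc, ← List.append_assoc,
        labelAt_append, labelAt_append] <;> simp [h₁]
    · intro i hi hi'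
      have h₁ : (i, y + g) ∈ s :=
        List.mem_append_right _ (mem_inRow.2 ⟨(ht₂ i).2 ⟨hi, hi'⟩, rfl⟩)
      have h₂ : f (i, y + g) = (i + D, y) := by simp [hf, shiftRow]
      have hinf : ∀ v ∈ s, Inside m T (f v) := fun v hv =>
        hin _ (by rw [hsf']; exact List.mem_append_left _ (List.mem_map_of_mem hv))
      have h₃ := labelAt_append (A := A) (m := m) (T := T) (inRow y t₃)
        (List.mem_map_of_mem (f := f) h₁)
      rw [labelAt_map hins hinf hrigid h₁, h₂, ← hsf'] at h₃
      exact h₃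
    · intro i hi hi'
      obtain ⟨c, hc, hcE, -⟩ := hA.exists_extension
        (nodup_append_inRow hnd hnd' fun v hv => by linarith [(hh v hv).2]) hin
      have h₁ : ∀ j : ℤ, 0 ≤ j → j ≤ D + w₂ →
          (j, y) ∈ h ++ inRow y (t₁ ++ t₂.map (· + (D : ℤ)) ++ t₃) := fun j hj hj' =>
        List.mem_append_right _ (mem_inRow.2 ⟨(hmem _).2 ⟨hj, by push_cast; exact hj'⟩, rfl⟩)
      have h₂ := h₁ i hi hi'.le
      have h₃ := h₁ (i + 1) (by omega) (by omega)
      rw [← hc _ h₂, ← hc _ h₃]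
      exact hcE _ _ (hin _ h₂) (hin _ h₃)

/-- A segment of a fresh row can be moved close to any segment of the same length of a row that
has been revealed before. -/
theorem Algorithm.Correct.abs_rowPotential_sub_le (hA : A.Correct m T) {M w : ℕ} {t₀ t : List ℤ}
    (hn₀ : t₀.Nodup) (ht₀ : ∀ x, x ∈ t₀ ↔ 0 ≤ x ∧ x ≤ M) (hn : t.Nodup)
    (ht : ∀ x, x ∈ t ↔ 0 ≤ x ∧ x ≤ w) (hM : M + w + T < m / 2) (hT : 2 * T + 2 + T < m / 2)
    {b k x : ℕ} (hb : b + k ≤ w) (hx : x + k ≤ M) :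
    |rowPotential (fun i => A.labelAt m T (inRow 0 t₀ ++ inRow (2 * T + 2) t) (i, 2 * T + 2)) b k -
      rowPotential (fun i => A.labelAt m T (inRow 0 t₀) (i, 0)) x k| ≤ 2 * (2 * T + 2) := by
  set g : ℤ := 2 * T + 2 with hg
  have hg0 : 0 < g := by positivity
  set s := inRow 0 t₀ ++ inRow g t with hs
  -- A horizontal slide putting abscissa `b` above `x`; the rows stay `2 * T + 2` apart, so it is
  -- rigid.
  set f := shiftRow g ((x : ℤ) - b) 0 with hf
  have hsf : s.map f = inRow 0 t₀ ++ inRow g (t.map (· + ((x : ℤ) - b))) := by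
    rw [hs, List.map_append, map_shiftRow_of_ne, map_shiftRow_inRow, add_zero]
    intro v hv
    rw [(mem_inRow.1 hv).2]
    exact hg0.ne
  have hins : ∀ v ∈ s, Inside m T v := by
    intro v hv
    rw [inside_iff]
    rcases List.mem_append.1 hv with hv | hv <;> obtain ⟨h₁, h₂⟩ := mem_inRow.1 hv
    · have h₁ := (ht₀ _).1 h₁
      refine ⟨⟨?_, ?_⟩, ?_, ?_⟩ <;> omega
    · have h₁ := (ht _).1 h₁
      refine ⟨⟨?_, ?_⟩, ?_, ?_⟩ <;> omega
  have hinsf : ∀ v ∈ s.map f, Inside m T v := by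
    intro v hv
    rw [inside_iff]
    rw [hsf] at hv
    rcases List.mem_append.1 hv with hv | hv <;> obtain ⟨h₁, h₂⟩ := mem_inRow.1 hv
    · have h₁ := (ht₀ _).1 h₁
      refine ⟨⟨?_, ?_⟩, ?_, ?_⟩ <;> omega
    · obtain ⟨z, hz, hz'⟩ := List.mem_map.1 h₁
      have hz := (ht _).1 hz
      refine ⟨⟨?_, ?_⟩, ?_, ?_⟩ <;> omega
  have hrigid : IsRigid T s f := by
    refine isRigid_shiftRow fun u hu v hv hu' hv' => ?_
    have hv'' : v.2 = 0 := by
      rcases List.mem_append.1 hv with hv | hv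
      · exact (mem_inRow.1 hv).2
      · exact absurd (mem_inRow.1 hv).2 hv'
    rw [hu', hv'', add_zero, sub_zero, abs_of_pos hg0]
    have h₄ := abs_nonneg (u.1 - v.1)
    have h₅ := abs_nonneg (u.1 + (x - b) - v.1)
    constructor <;> linarith
  have hnodup : (s.map f).Nodup := by
    rw [hsf]
    refine nodup_append_inRow ?_ (hn.map (add_left_injective _)) fun v hv => ?_
    · exact hn₀.map fun a b hab => (Prod.mk.inj hab).1
    · rw [(mem_inRow.1 hv).2]
      exact hg0
  obtain ⟨c, hc, hcE, hcN⟩ := hA.exists_extension hnodup hinsf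
  have hcg : rowPotential (fun i => c (i, 0 + ((2 * T + 2 : ℕ) : ℤ))) x k =
      rowPotential (fun i => A.labelAt m T s (i, g)) b k := by
    refine rowPotential_congr fun i hi hi' => ?_
    have h₁ : ((b : ℤ) + i, g) ∈ s :=
      List.mem_append_right _ (mem_inRow.2 ⟨(ht _).2 ⟨by omega, by omega⟩, rfl⟩)
    have h₂ : f ((b : ℤ) + i, g) = ((x : ℤ) + i, 0 + ((2 * T + 2 : ℕ) : ℤ)) := by
      simp only [hf, shiftRow, if_true, Prod.mk.injEq]
      constructor
      · ring
      · push_cast; ring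
    rw [← h₂, hc _ (List.mem_map_of_mem h₁), labelAt_map hins
      (fun v hv => hinsf _ (List.mem_map_of_mem hv)) hrigid h₁]
  have hc0 : rowPotential (fun i => c (i, 0)) x k =
      rowPotential (fun i => A.labelAt m T (inRow 0 t₀) (i, 0)) x k := by
    refine rowPotential_congr fun i hi hi' => ?_
    have h₁ : ((x : ℤ) + i, (0 : ℤ)) ∈ inRow 0 t₀ :=
      mem_inRow.2 ⟨(ht₀ _).2 ⟨by omega, by omega⟩, rfl⟩
    rw [hc _ (by rw [hsf]; exact List.mem_append_left _ h₁), hsf, labelAt_append _ h₁]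
  have h := OnlineGrid.abs_rowPotential_sub_le (c := c) (a := x) (y := 0) (n := k) (2 * T + 2)
    (fun z y' h₁ h₂ h₃ h₄ => hcE _ _ (inside_iff.2 (by push_cast at h₄; dsimp only; omega))
      (inside_iff.2 (by push_cast at h₄; dsimp only; omega)))
    (fun z y' h₁ h₂ h₃ h₄ => hcN _ _ (inside_iff.2 (by push_cast at h₄; dsimp only; omega))
      (inside_iff.2 (by push_cast at h₄; dsimp only; omega)))
  rw [hcg, hc0] at h
  push_cast at h
  exact h

/-- Every segment of a row that is revealed after a row of length `M` has nearly the slope of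
that row. -/
theorem Algorithm.Correct.abs_deviation_le {A : Algorithm} {m T : ℕ} [NeZero m]
    (hA : A.Correct m T) {M w : ℕ} {q : ℤ} {t₀ t : List ℤ}
    (hn₀ : t₀.Nodup) (ht₀ : ∀ x, x ∈ t₀ ↔ 0 ≤ x ∧ x ≤ M) (hn : t.Nodup)
    (ht : ∀ x, x ∈ t ↔ 0 ≤ x ∧ x ≤ w) (hM : M + w + T < m / 2) (hT : 2 * T + 2 + T < m / 2)
    (hq : rowPotential (fun i => A.labelAt m T (inRow 0 t₀) (i, 0)) 0 M = q)
    (hw : 2 * w ^ 2 ≤ M) {b k : ℕ} (hb : b + k ≤ w) :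
    |deviation M q
      (fun i => A.labelAt m T (inRow 0 t₀ ++ inRow (2 * T + 2) t) (i, 2 * T + 2)) b k| ≤
      M * (4 * T + 5) := by
  rcases Nat.eq_zero_or_pos k with rfl | hk
  · simp only [deviation, rowPotential, Finset.range_zero, Finset.sum_empty, mul_zero,
      Nat.cast_zero, sub_zero, abs_zero]
    positivity
  set F := fun i => A.labelAt m T (inRow 0 t₀ ++ inRow (2 * T + 2) t) (i, 2 * T + 2)
  set F₀ := fun i => A.labelAt m T (inRow 0 t₀) (i, 0)
  have hclose : ∀ x : ℕ, x + k ≤ M →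
      |deviation M q F b k - deviation M q F₀ x k| ≤ M * (4 * T + 4) := by
    intro x hx
    have h := hA.abs_rowPotential_sub_le hn₀ ht₀ hn ht hM hT hb hx
    have h' := mul_le_mul_of_nonneg_left h (Nat.cast_nonneg (α := ℤ) M)
    rw [← abs_of_nonneg (Nat.cast_nonneg (α := ℤ) M), ← abs_mul,
      abs_of_nonneg (Nat.cast_nonneg (α := ℤ) M)] at h'
    refine (le_of_eq ?_).trans (h'.trans (le_of_eq (by ring)))
    unfold deviation
    congr 1
    ring
  set G : ℕ → ℤ := fun x => deviation M q F₀ 0 x with hG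
  have hGadd : ∀ x n, G (x + n) - G x = deviation M q F₀ x n := by
    intro x n
    simp only [hG, deviation_add, zero_add]
    ring
  have hG0 : G 0 = 0 := by simp [hG, deviation, rowPotential]
  have hGM : G M = 0 := by
    simp only [hG, deviation, hq]
    ring
  have hGlip : ∀ x n, |G (x + n) - G x| ≤ 2 * M * n := by
    intro x n
    have h₁ := abs_rowPotential_le F₀ x n
    have h₂ := hq ▸ abs_rowPotential_le F₀ 0 M
    rw [hGadd, deviation]
    refine (abs_sub _ _).trans ?_
    rw [abs_mul, abs_mul, Nat.abs_cast, Nat.abs_cast]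
    have h₃ := mul_le_mul_of_nonneg_left h₁ (Nat.cast_nonneg (α := ℤ) M)
    have h₄ := mul_le_mul_of_nonneg_right h₂ (Nat.cast_nonneg (α := ℤ) n)
    linarith
  have hkM : 2 * k ^ 2 ≤ M :=
    (Nat.mul_le_mul_left 2 (Nat.pow_le_pow_left (by omega : k ≤ w) 2)).trans hw
  -- Placing the segment over `x` bounds its deviation above, placing it over `z` bounds it below.
  obtain ⟨x, hx, hx'⟩ := exists_small_increment hG0 hGM hGlip hk hkM
  obtain ⟨z, hz, hz'⟩ := exists_small_increment (G := fun x => -G x) (by simp [hG0])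
    (by simp [hGM]) (fun x n => by
      rw [neg_sub_neg, abs_sub_comm]
      exact hGlip x n) hk hkM
  have h₁ := abs_le.1 (hclose x hx)
  have h₂ := abs_le.1 (hclose z hz)
  rw [hGadd] at hx'
  have hz'' : -deviation M q F₀ z k ≤ M := by
    rw [← hGadd]
    linarith
  rw [abs_le]
  constructor <;> linarith

/-- No algorithm of locality `T` properly 3-colors an `m × m` oriented grid with
`m ≥ 2 ^ (100 * (T + 1))`: 3-coloring oriented grids has locality `Ω(log n)`.

The adversary reveals a long row segment, of potential `q` and length `M`. Far away from it, it then
creates a row segment in which two subsegments deviate in opposite directions from the slope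
`q / M`, one of them by a large amount. That one is finally placed next to a subsegment of the same
length of the first row which has about the slope `q / M`, which is impossible in a proper
coloring. -/
theorem Algorithm.not_correct (A : Algorithm) {T m : ℕ} (hm : 2 ^ (100 * (T + 1)) ≤ m) :
    ¬ A.Correct m T := by
  intro hA
  have : NeZero m := ⟨(lt_of_lt_of_le (by positivity) hm).ne'⟩
  -- `32 * T + 41 = 8 * (4 * T + 5) + 1`: the spread `L / 4` just exceeds twice the allowed
  -- deviation.
  obtain ⟨L, hL⟩ : ∃ L, L = 32 * T + 41 := ⟨_, rfl⟩
  obtain ⟨S, hS⟩ : ∃ S, S = 2 ^ L * (2 * T + 4) := ⟨_, rfl⟩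
  -- `S` bounds the fragment width, and `abs_deviation_le` needs `2 * w ^ 2 ≤ M`. Evenness of `M`
  -- serves the bound `2 * |q| ≤ M`.
  obtain ⟨M, hM⟩ : ∃ M, M = 2 * S ^ 2 := ⟨_, rfl⟩
  have hLS : L + 1 ≤ 2 ^ L := Nat.lt_two_pow_self
  have hLT : (L + 1) * (2 * T + 2) + 1 ≤ S := by
    rw [hS]
    nlinarith
  have hTS : 3 * T + 2 ≤ S := by nlinarith
  have hS1 : 1 ≤ S := by omega
  have hSM : 2 * S ≤ M := by rw [hM]; nlinarith
  have hMm : 8 * M ≤ m := by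
    have h₁ : 2 * T + 4 ≤ 2 ^ (T + 2) := by
      have : T + 2 ≤ 2 ^ (T + 1) := Nat.lt_two_pow_self
      rw [pow_succ]
      omega
    have h₂ : S ≤ 2 ^ (L + (T + 2)) := by
      rw [pow_add, hS]
      exact Nat.mul_le_mul_left _ h₁
    calc 8 * M = 2 ^ 4 * S ^ 2 := by rw [hM]; ring
      _ ≤ 2 ^ 4 * (2 ^ (L + (T + 2))) ^ 2 := by gcongr
      _ = 2 ^ (4 + (L + (T + 2)) * 2) := by rw [← pow_mul, ← pow_add]
      _ ≤ 2 ^ (100 * (T + 1)) := Nat.pow_le_pow_right (by norm_num) (by omega)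
      _ ≤ m := hm
  obtain ⟨t₀, ht₀⟩ : ∃ t₀, t₀ = intRange 0 (M + 1) := ⟨_, rfl⟩
  have hn₀ : t₀.Nodup := ht₀ ▸ nodup_intRange _ _
  have hmem₀ : ∀ x, x ∈ t₀ ↔ 0 ≤ x ∧ x ≤ M := by
    intro x
    rw [ht₀, mem_intRange]
    push_cast
    omega
  have hnd₀ : (inRow 0 t₀).Nodup := hn₀.map fun a b hab => (Prod.mk.inj hab).1
  have hin₀ : ∀ v ∈ inRow 0 t₀, Inside m T v := by
    intro v hv
    obtain ⟨h₁, h₂⟩ := mem_inRow.1 hv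
    have h₁ := (hmem₀ _).1 h₁
    rw [inside_iff]
    refine ⟨⟨?_, ?_⟩, ?_, ?_⟩ <;> omega
  obtain ⟨q, hq⟩ : ∃ q, rowPotential (fun i => A.labelAt m T (inRow 0 t₀) (i, 0)) 0 M = q :=
    ⟨_, rfl⟩
  have hqM : 2 * |q| ≤ (M : ℤ) := by
    obtain ⟨c, hc, hcE, -⟩ := hA.exists_extension hnd₀ hin₀
    have h₁ : ∀ i : ℤ, 0 ≤ i → i ≤ M → (i, (0 : ℤ)) ∈ inRow 0 t₀ := fun i hi hi' =>
      mem_inRow.2 ⟨(hmem₀ i).2 ⟨hi, hi'⟩, rfl⟩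
    have h₂ := abs_rowPotential_two_mul_le (f := fun i => A.labelAt m T (inRow 0 t₀) (i, 0))
      (a := 0) (n := S ^ 2) fun i hi hi' => by
        have h₃ := h₁ i hi (by omega)
        have h₄ := h₁ (i + 1) (by omega) (by omega)
        rw [← hc _ h₃, ← hc _ h₄]
        exact hcE _ _ (hin₀ _ h₃) (hin₀ _ h₄)
    rw [← hM] at h₂
    rw [hq] at h₂
    omega
  obtain ⟨w, t, hw, hn, ht, a, n, b, k, ha, hb, hspread⟩ :=
    hA.exists_fragment hqM L (inRow 0 t₀) (2 * T + 2) hnd₀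
      (fun v hv => ⟨hin₀ v hv, by linarith [(mem_inRow.1 hv).2]⟩) (by positivity)
      (by
        have : 2 * T + 2 + L * (2 * T + 2) + T < m / 2 := by
          rw [add_one_mul] at hLT
          omega
        exact_mod_cast this)
      (by omega)
  have hdev : ∀ b k : ℕ, b + k ≤ w → _ := fun b k hb =>
    hA.abs_deviation_le hn₀ hmem₀ hn ht (by omega) (by omega) hq
      ((Nat.mul_le_mul_left 2 (Nat.pow_le_pow_left (by omega : w ≤ S) 2)).trans_eq hM.symm) hb
  have h₁ := abs_le.1 (hdev a n ha)
  have h₂ := abs_le.1 (hdev b k hb)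
  have hM0 : (0 : ℤ) < M := by exact_mod_cast (by omega : 0 < M)
  have hLM : (L * M : ℤ) = 8 * (M * (4 * T + 5)) + M := by
    rw [hL]
    push_cast
    ring
  linarith

end OnlineGrid

/-- The lemma on zero-potential L-paths is a step in a proof by contradiction that no correct
algorithm exists in this range of `T` and `m`. Here that impossibility, `Algorithm.not_correct`, is
proved directly, and the lemma follows from it. -/
theorem mainTheorem4 :
    ∃ C : ℕ, ∀ T m : ℕ, 2 ^ (C * (T + 1)) ≤ m →
      ∀ A : OnlineGrid.Algorithm, A.Correct m T →
        ∃ (s : List (OnlineGrid.Node m)) (u v : OnlineGrid.Node m)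
          (W : (OnlineGrid.gridGraph m).Walk u v) (i : ℕ),
          (OnlineGrid.IsLPath W i ∨ OnlineGrid.IsTransposedLPath W i) ∧
          (A.DirectedOnly → OnlineGrid.IsLPath W i) ∧
          2 ^ (100 * T) ≤ i ∧
          W.length - i < i ∧
          W.support.length ≤ 2 ^ (C * (T + 1)) ∧
          s.Perm W.support ∧
          OnlineGrid.potential (A.color m T s) W = 0 :=
  ⟨100, fun _ _ hm A hA => absurd hA (A.not_correct hm)⟩
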